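/- Throughout, vector lattices are real and Archimedean. An $f$-algebra is a vector lattice $A$ with an associative bilinear multiplication (no unit is required) such that products of positive elements are positive and $a\wedge b=0$, $c\ge 0$ imply $(ac)\wedge b=(ca)\wedge b=0$. It is uniformly complete if for every $u\ge 0$ each $u$-uniform Cauchy sequence has a $u$-uniform limit, and semiprime if $0$ is its only nilpotent element. It has the weak factorization property if for every $a\in A$ there are $b,c\in A$ with $a\le bc$. An element $\varphi$ of a vector lattice $V$ is finite if there is $z\in V$, $z\ge 0$, such that for every $x\in V$ there is $c_x>0$ with $|x|\wedge n|\varphi|\le c_x z$ for all $n\in\mathbb N$; $\Phi_1(V)$ is the set of all finite elements of $V$. For $p\ge 2$ let $\Pi_p(A)=\{g_1\cdots g_p : g_1,\dots,g_p\in A\}$, with the order and the algebraic operations inherited from $A$; for a uniformly complete $f$-algebra $A$ it is a vector lattice in its own right, and $\Phi_1(\Pi_p(A))$ is formed with its own lattice operations. Let $A$ be a uniformly complete $f$-algebra and let $p\ge 2$ be an integer. Then 1. if $g_1,\dots,g_p$ are finite in $A$, then $g_1\cdots g_p$ is finite in $\Pi_p(A)$. If, in addition, $A$ is semiprime, then 2.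 if $g_1\cdots g_p$ (with $g_1,\dots,g_p\in A$) is finite in $\Pi_p(A)$, then its $p$-th root is finite in $A$; precisely: $|g_1\cdots g_p|$ has a unique $p$-th root $r\ge 0$ in $A$, and every element of $A$ whose $p$-th power is $|g_1\cdots g_p|$ or $g_1\cdots g_p$ is finite in $A$ (for $g_1\cdots g_p\ge 0$, in particular for $g_1,\dots,g_p\ge 0$, this says that $(g_1\cdots g_p)^{1/p}$ exists and is finite in $A$); 3. if $g_1,\dots,g_p$ are finite in $A$, then the $p$-th root of $g_1\cdots g_p$ is finite in $A$, in the same sense as in 2; 4. $\Phi_1(\Pi_p(A))\subseteq\Phi_1(A)$; 5. if $A$ has the weak factorization property, then $\Phi_1(\Pi_p(A))=\Phi_1(A)\cap\Pi_p(A)$. -/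

import Mathlib

namespace FAlgebra

/-! ### Vector lattices: Archimedean property, uniform completeness -/

section VectorLattice

variable (V : Type*) [AddCommGroup V] [Lattice V] [IsOrderedAddMonoid V] [Module ℝ V]

/-- A vector lattice is Archimedean if `0 ≤ x`, `0 ≤ y` and `n x ≤ y` for all `n` force `x = 0`.
(Mathlib's `Archimedean` is a much stronger property.) -/
def IsArchimedean : Prop :=
  ∀ x y : V, 0 ≤ x → 0 ≤ y → (∀ n : ℕ, n • x ≤ y) → x = 0

/-- Relative uniform completeness: for every `u ≥ 0`, every `u`-uniform Cauchy sequence has a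
`u`-uniform limit. -/
def IsUniformlyComplete : Prop :=
  ∀ u : V, 0 ≤ u → ∀ x : ℕ → V,
    (∀ ε : ℝ, 0 < ε → ∃ N : ℕ, ∀ m ≥ N, ∀ n ≥ N, |x m - x n| ≤ ε • u) →
    ∃ l : V, ∀ ε : ℝ, 0 < ε → ∃ N : ℕ, ∀ n ≥ N, |x n - l| ≤ ε • u

variable {V}

/-! ### Finite elements of a vector lattice -/

/-- `z` is a majorant of `φ` in the vector lattice `V`. -/
def IsMajorant (φ z : V) : Prop :=
  0 ≤ z ∧ ∀ x : V, ∃ c : ℝ, 0 < c ∧ ∀ n : ℕ, |x| ⊓ n • |φ| ≤ c • z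

variable (V) in
/-- The set `Φ₁(V)` of all finite elements of `V`. -/
def finiteElements : Set V := {φ | ∃ z : V, IsMajorant φ z}

/-! ### Finite elements of a subset with the inherited order and algebraic operations

The lattice operations below are those of the subset `S` with the order inherited from `V`;
they are not taken to be the ones of `V`. -/

/-- `m` is the modulus of `x` in `S`: the least upper bound of `x` and `-x` inside `S`. -/
def IsModulusIn (S : Set V) (x m : V) : Prop :=
  m ∈ S ∧ x ≤ m ∧ -x ≤ m ∧ ∀ y ∈ S, x ≤ y → -x ≤ y → m ≤ y

/-- `w` is the infimum of `a` and `b` in `S`: the greatest lower bound inside `S`. -/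
def IsInfIn (S : Set V) (a b w : V) : Prop :=
  w ∈ S ∧ w ≤ a ∧ w ≤ b ∧ ∀ y ∈ S, y ≤ a → y ≤ b → y ≤ w

/-- `z` is a majorant of `φ` in `S`: `z ∈ S`, `z ≥ 0`, and for each `x ∈ S` there is `c > 0` with
`|x| ∧ n|φ| ≤ c z` for all `n`, where modulus and infimum are formed (and exist) in `S`. -/
def IsMajorantIn (S : Set V) (φ z : V) : Prop :=
  z ∈ S ∧ 0 ≤ z ∧ ∀ x ∈ S, ∃ c : ℝ, 0 < c ∧ ∀ n : ℕ,
    ∃ a m w : V, IsModulusIn S x a ∧ IsModulusIn S φ m ∧ IsInfIn S a (n • m) w ∧ w ≤ c • z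

/-- The set `Φ₁(S)` of all finite elements of `S`, for `S` with the inherited order. -/
def finiteElementsIn (S : Set V) : Set V := {φ | φ ∈ S ∧ ∃ z : V, IsMajorantIn S φ z}

/-- On all of `V` the two notions of finite element agree. -/
theorem finiteElementsIn_univ : finiteElementsIn (Set.univ : Set V) = finiteElements V := by
  have hmod : ∀ x : V, IsModulusIn Set.univ x |x| := fun x =>
    ⟨Set.mem_univ _, le_abs_self x, neg_le_abs x, fun y _ h1 h2 => abs_le'.2 ⟨h1, h2⟩⟩
  have hinf : ∀ a b : V, IsInfIn Set.univ a b (a ⊓ b) := fun a b =>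
    ⟨Set.mem_univ _, inf_le_left, inf_le_right, fun y _ h1 h2 => le_inf h1 h2⟩
  ext φ
  constructor
  · rintro ⟨-, z, -, hz, h⟩
    refine ⟨z, hz, fun x => ?_⟩
    obtain ⟨c, hc, hn⟩ := h x (Set.mem_univ _)
    refine ⟨c, hc, fun n => ?_⟩
    obtain ⟨a, m, w, ha, hm, hw, hle⟩ := hn n
    have hxa : |x| ≤ a := abs_le'.2 ⟨ha.2.1, ha.2.2.1⟩
    have hφm : |φ| ≤ m := abs_le'.2 ⟨hm.2.1, hm.2.2.1⟩
    refine (hw.2.2.2 _ (Set.mem_univ _) (inf_le_left.trans hxa) ?_).trans hle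
    exact inf_le_right.trans (nsmul_le_nsmul_right hφm n)
  · rintro ⟨z, hz, h⟩
    refine ⟨Set.mem_univ _, z, Set.mem_univ _, hz, fun x _ => ?_⟩
    obtain ⟨c, hc, hn⟩ := h x
    exact ⟨c, hc, fun n => ⟨_, _, _, hmod x, hmod φ, hinf _ _, hn n⟩⟩

end VectorLattice

/-! ### Products and powers in an algebra without unit -/

section Products

variable {A : Type*} [NonUnitalRing A]

/-- The product `g₁ ⋯ g_p` of `p ≥ 1` elements, in this order. (The empty product, which has no
meaning without a unit, gets the value `0`; it is not used.) -/
def prod : (p : ℕ) → (Fin p → A) → A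
  | 0, _ => 0
  | 1, g => g 0
  | n + 2, g => prod (n + 1) (fun i => g i.castSucc) * g (Fin.last (n + 1))

/-- The power `a ^ p` for `p ≥ 1`. -/
def power (a : A) (p : ℕ) : A := prod p (fun _ => a)

variable (A) in
/-- The set `Π_p(A)` of all `p`-fold products. -/
def productAlgebra (p : ℕ) : Set A := Set.range (fun g : Fin p → A => prod p g)

variable (A) in
/-- `0` is the only nilpotent element. -/
def IsSemiprime : Prop := ∀ a : A, (∃ n : ℕ, 1 ≤ n ∧ power a n = 0) → a = 0

end Products

/-! ### `f`-algebras -/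

section FAlg

variable (A : Type*) [NonUnitalRing A] [Lattice A]

/-- The two order conditions on the multiplication of an `f`-algebra. -/
structure IsFAlgebra : Prop where
  mul_nonneg : ∀ a b : A, 0 ≤ a → 0 ≤ b → 0 ≤ a * b
  mul_inf_eq_zero : ∀ a b c : A, a ⊓ b = 0 → 0 ≤ c → (a * c) ⊓ b = 0 ∧ (c * a) ⊓ b = 0

/-- Every element lies below a product of two elements. -/
def HasWeakFactorization : Prop := ∀ a : A, ∃ b c : A, a ≤ b * c

end FAlg

end FAlgebra

/-!
An `f`-algebra multiplication is read off from the lattice homomorphisms `ω` into `ℝ` that are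
defined on a principal ideal and take the value `1` at its generator: such characters separate the
points of the ideal (Yosida), and every character at `e ^ p` sends `f₁ ⋯ f_p` to `χ f₁ ⋯ χ f_p` for
a single character `χ` at `e`, because disjoint elements have product zero. By uniform completeness
and the lattice form of the Stone–Weierstrass theorem the geometric mean of nonnegative `gᵢ` exists
as an element `r`, and evaluating at characters gives `r ^ p = g₁ ⋯ g_p`. So `Π_p(A)` consists of
the `p`-th powers up to sign, and since `r ↦ r ^ p` preserves infima of nonnegative elements (and
reflects the order when `A` is semiprime), majorants may be carried back and forth between `A` and
`Π_p(A)`. Finally `g₁ ⋯ g_p` lies in the band generated by `r`, and that band inherits finiteness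
from `r`.
-/

namespace FAlgebra

/-! ### Disjoint elements -/

section LatticeOrderedGroup

variable {V : Type*} [AddCommGroup V] [Lattice V] [IsOrderedAddMonoid V]

theorem inf_add_le_inf_add_inf {a b c : V} (ha : 0 ≤ a) (hb : 0 ≤ b) (hc : 0 ≤ c) :
    a ⊓ (b + c) ≤ a ⊓ b + a ⊓ c := by
  rw [add_inf, inf_add, inf_add]
  refine le_inf (le_inf ?_ ?_) (le_inf ?_ inf_le_right)
  · exact inf_le_left.trans (le_add_of_nonneg_right ha)
  · exact inf_le_left.trans (le_add_of_nonneg_left hb)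
  · exact inf_le_left.trans (le_add_of_nonneg_right hc)

theorem inf_add_eq_zero {a b c : V} (hab : a ⊓ b = 0) (hac : a ⊓ c = 0) : a ⊓ (b + c) = 0 := by
  have ha : 0 ≤ a := hab ▸ inf_le_left
  have hb : 0 ≤ b := hab ▸ inf_le_right
  have hc : 0 ≤ c := hac ▸ inf_le_right
  refine le_antisymm ((inf_add_le_inf_add_inf ha hb hc).trans ?_) (le_inf ha (add_nonneg hb hc))
  rw [hab, hac, add_zero]

theorem inf_nsmul_eq_zero {a b : V} (h : a ⊓ b = 0) (n : ℕ) : a ⊓ n • b = 0 := by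
  induction n with
  | zero => rw [zero_smul, inf_eq_right, ← h]; exact inf_le_left
  | succ n ih => rw [succ_nsmul]; exact inf_add_eq_zero ih h

theorem abs_sub_eq_add_of_abs_inf_abs_eq_zero {a b : V} (h : |a| ⊓ |b| = 0) :
    |a - b| = |a| + |b| := by
  refine le_antisymm ?_ ?_
  · simpa only [sub_eq_add_neg, abs_neg] using abs_add_le a (-b)
  · calc |a| + |b| = |(|a| - |b|)| := by
          rw [abs_sub_comm, ← sup_sub_inf_eq_abs_sub, h, sub_zero, ← inf_add_sup |a|, h, zero_add]
      _ ≤ |a - b| := abs_abs_sub_abs_le a b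

theorem nsmul_inf_le_of_forall_inf_nsmul_le {y r w : V} (hy : 0 ≤ y) (h : ∀ n : ℕ, y ⊓ n • r ≤ w)
    (n : ℕ) : n • ((y - w)⁺ ⊓ r) ≤ y := by
  induction n with
  | zero => rwa [zero_smul]
  | succ n ih =>
    set s := (y - w)⁺ ⊓ r
    have hns : n • s ≤ y ⊓ n • r := le_inf ih (nsmul_le_nsmul_right inf_le_right n)
    have hs : s ≤ y - y ⊓ n • r := inf_le_left.trans <|
      sup_le (sub_le_sub_left (h n) y) (sub_nonneg.2 inf_le_left)
    calc (n + 1) • s = n • s + s := succ_nsmul s n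
      _ ≤ y ⊓ n • r + (y - y ⊓ n • r) := add_le_add hns hs
      _ = y := add_sub_cancel _ _

end LatticeOrderedGroup

/-! ### Solid subspaces -/

section SolidSubspace

open LatticeOrderedAddCommGroup

variable {V : Type*} [AddCommGroup V] [Lattice V] [Module ℝ V]

theorem abs_smul_le [IsOrderedModule ℝ V] (c : ℝ) (x : V) : |c • x| ≤ |c| • |x| := by
  have smul_le (d : ℝ) (y : V) : d • y ≤ |d| • |y| := by
    rcases le_total 0 d with h | h
    · rw [abs_of_nonneg h]
      exact smul_le_smul_of_nonneg_left (le_abs_self y) h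
    · rw [abs_of_nonpos h, ← neg_smul_neg]
      exact smul_le_smul_of_nonneg_left (neg_le_abs y) (neg_nonneg.2 h)
  refine abs_le'.2 ⟨smul_le c x, ?_⟩
  simpa only [neg_smul, abs_neg] using smul_le (-c) x

/-- `J` is maximal among the solid subspaces that do not contain `u`. Its quotient restricts to the
real line on the principal ideal of `u`, so these subspaces are the kernels of characters. -/
def IsMaximalAvoiding (J : Submodule ℝ V) (u : V) : Prop :=
  Maximal (fun K : Submodule ℝ V => IsSolid (K : Set V) ∧ u ∉ K) J

theorem exists_isMaximalAvoiding {I : Submodule ℝ V} {u : V} (hI : IsSolid (I : Set V))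
    (hu : u ∉ I) : ∃ J, I ≤ J ∧ IsMaximalAvoiding J u := by
  refine zorn_le_nonempty₀ {K : Submodule ℝ V | IsSolid (K : Set V) ∧ u ∉ K} ?_ I ⟨hI, hu⟩
  intro c hc hchain K hK
  have mem_sSup {x : V} : x ∈ sSup c ↔ ∃ L ∈ c, x ∈ L :=
    Submodule.mem_sSup_of_directed ⟨K, hK⟩ hchain.directedOn
  refine ⟨sSup c, ⟨fun x hx y hyx => ?_, fun hx => ?_⟩, fun L hL => le_sSup hL⟩
  · obtain ⟨L, hL, hxL⟩ := mem_sSup.1 hx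
    exact mem_sSup.2 ⟨L, hL, (hc hL).1 hxL hyx⟩
  · obtain ⟨L, hL, hxL⟩ := mem_sSup.1 hx
    exact (hc hL).2 hxL

theorem IsMaximalAvoiding.isSolid {J : Submodule ℝ V} {u : V} (hJ : IsMaximalAvoiding J u) :
    IsSolid (J : Set V) :=
  hJ.prop.1

theorem IsMaximalAvoiding.notMem {J : Submodule ℝ V} {u : V} (hJ : IsMaximalAvoiding J u) :
    u ∉ J :=
  hJ.prop.2

variable [IsOrderedAddMonoid V]

section Lattice

variable {J : Submodule ℝ V} (hJ : IsSolid (J : Set V)) {x y : V}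
include hJ

theorem mem_of_nonneg_of_le (hy : y ∈ J) (h0 : 0 ≤ x) (h : x ≤ y) : x ∈ J :=
  hJ hy (by rwa [abs_of_nonneg h0, abs_of_nonneg (h0.trans h)])

theorem abs_mem_of_isSolid (hx : x ∈ J) : |x| ∈ J :=
  hJ hx (abs_abs x).le

theorem sup_mem_of_isSolid (hx : x ∈ J) (hy : y ∈ J) : x ⊔ y ∈ J := by
  rw [sup_eq_half_smul_add_add_abs_sub' ℝ]
  exact J.smul_mem _ (J.add_mem (J.add_mem hx hy) (abs_mem_of_isSolid hJ (J.sub_mem hy hx)))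

theorem inf_mem_of_isSolid (hx : x ∈ J) (hy : y ∈ J) : x ⊓ y ∈ J := by
  rw [inf_eq_half_smul_add_sub_abs_sub' ℝ]
  exact J.smul_mem _ (J.sub_mem (J.add_mem hx hy) (abs_mem_of_isSolid hJ (J.sub_mem hy hx)))

theorem posPart_mem_of_isSolid (hx : x ∈ J) : x⁺ ∈ J :=
  sup_mem_of_isSolid hJ hx J.zero_mem

end Lattice

variable [IsOrderedModule ℝ V]

theorem abs_smul_of_nonneg (c : ℝ) {x : V} (hx : 0 ≤ x) : |c • x| = |c| • x := by
  rcases le_total 0 c with h | h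
  · rw [abs_of_nonneg h, abs_of_nonneg (smul_nonneg h hx)]
  · rw [abs_of_nonpos h, abs_of_nonpos (smul_nonpos_of_nonpos_of_nonneg h hx), neg_smul]

theorem inf_smul_eq_zero {a b : V} (h : a ⊓ b = 0) {c d : ℝ} (hc : 0 ≤ c) (hd : 0 ≤ d) :
    c • a ⊓ d • b = 0 := by
  have ha : 0 ≤ a := h ▸ inf_le_left
  have hb : 0 ≤ b := h ▸ inf_le_right
  have hK : 0 < c + d + 1 := by positivity
  refine le_antisymm ?_ (le_inf (smul_nonneg hc ha) (smul_nonneg hd hb))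
  calc c • a ⊓ d • b ≤ (c + d + 1) • a ⊓ (c + d + 1) • b :=
        inf_le_inf (smul_le_smul_of_nonneg_right (by linarith) ha)
          (smul_le_smul_of_nonneg_right (by linarith) hb)
    _ = (c + d + 1) • (a ⊓ b) := ((OrderIso.smulRight hK).map_inf a b).symm
    _ = 0 := by rw [h, smul_zero]

/-- The subspace of all `x` with `|x| ≤ j + c • a` for some `j ∈ J` and `c : ℝ`. For `J` solid and
`a ≥ 0` it is the smallest solid subspace that contains `J` and `a`. -/
def solidAdjoin (J : Submodule ℝ V) (a : V) : Submodule ℝ V where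
  carrier := {x | ∃ j ∈ J, ∃ c : ℝ, |x| ≤ j + c • a}
  zero_mem' := ⟨0, J.zero_mem, 0, by simp⟩
  add_mem' := by
    rintro x y ⟨j, hj, c, hx⟩ ⟨k, hk, d, hy⟩
    refine ⟨j + k, J.add_mem hj hk, c + d, ?_⟩
    calc |x + y| ≤ |x| + |y| := abs_add_le x y
      _ ≤ (j + c • a) + (k + d • a) := add_le_add hx hy
      _ = (j + k) + (c + d) • a := by module
  smul_mem' := by
    rintro t x ⟨j, hj, c, hx⟩
    refine ⟨|t| • j, J.smul_mem _ hj, |t| * c, ?_⟩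
    calc |t • x| ≤ |t| • |x| := abs_smul_le t x
      _ ≤ |t| • (j + c • a) := smul_le_smul_of_nonneg_left hx (abs_nonneg t)
      _ = |t| • j + (|t| * c) • a := by module

theorem isSolid_solidAdjoin (J : Submodule ℝ V) (a : V) : IsSolid (solidAdjoin J a : Set V) := by
  rintro x ⟨j, hj, c, hx⟩ y hy
  exact ⟨j, hj, c, hy.trans hx⟩

theorem self_mem_solidAdjoin (J : Submodule ℝ V) {a : V} (ha : 0 ≤ a) : a ∈ solidAdjoin J a :=
  ⟨0, J.zero_mem, 1, by simp [abs_of_nonneg ha]⟩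

/-- The solid subspace (order ideal) generated by `u ≥ 0`. -/
def principalIdeal (u : V) : Submodule ℝ V := solidAdjoin ⊥ u

theorem mem_principalIdeal {u x : V} : x ∈ principalIdeal u ↔ ∃ c : ℝ, |x| ≤ c • u := by
  constructor
  · rintro ⟨j, hj, c, h⟩
    rw [(Submodule.mem_bot ℝ).1 hj, zero_add] at h
    exact ⟨c, h⟩
  · rintro ⟨c, h⟩
    exact ⟨0, Submodule.zero_mem _, c, by rwa [zero_add]⟩

theorem principalIdeal_le {J : Submodule ℝ V} (hJ : IsSolid (J : Set V)) {u : V} (hu : u ∈ J) :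
    principalIdeal u ≤ J := by
  intro x hx
  obtain ⟨c, hc⟩ := mem_principalIdeal.1 hx
  exact hJ (J.smul_mem c hu) (hc.trans (le_abs_self _))

theorem eq_zero_of_mem_principalIdeal {a b : V} (h : a ⊓ b = 0) (hab : a ∈ principalIdeal b) :
    a = 0 := by
  obtain ⟨c, hc⟩ := mem_principalIdeal.1 hab
  have hle : a ≤ |c| • b := (le_abs_self a).trans <| hc.trans <|
    smul_le_smul_of_nonneg_right (le_abs_self c) (h ▸ inf_le_right)
  have hinf := inf_smul_eq_zero h zero_le_one (abs_nonneg c)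
  rwa [one_smul, inf_eq_left.2 hle] at hinf

theorem isSolid_principalIdeal (u : V) : IsSolid (principalIdeal u : Set V) :=
  isSolid_solidAdjoin ⊥ u

theorem self_mem_principalIdeal {u : V} (hu : 0 ≤ u) : u ∈ principalIdeal u :=
  self_mem_solidAdjoin ⊥ hu

namespace IsMaximalAvoiding

variable {J : Submodule ℝ V} {u : V} (hJ : IsMaximalAvoiding J u)
include hJ

theorem exists_le_add_smul {a : V} (ha : 0 ≤ a) (haJ : a ∉ J) :
    ∃ j ∈ J, 0 ≤ j ∧ ∃ c : ℝ, 0 ≤ c ∧ u ≤ j + c • a := by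
  have hle : J ≤ solidAdjoin J a := fun x hx =>
    ⟨|x|, abs_mem_of_isSolid hJ.isSolid hx, 0, by simp⟩
  have hu : u ∈ solidAdjoin J a := by
    by_contra hu
    exact haJ (hJ.le_of_ge ⟨isSolid_solidAdjoin J a, hu⟩ hle (self_mem_solidAdjoin J ha))
  obtain ⟨j, hj, c, h⟩ := hu
  refine ⟨|j|, abs_mem_of_isSolid hJ.isSolid hj, abs_nonneg j, |c|, abs_nonneg c, ?_⟩
  calc u ≤ |u| := le_abs_self u
    _ ≤ j + c • a := h
    _ ≤ |j| + |c| • a :=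
      add_le_add (le_abs_self j) (smul_le_smul_of_nonneg_right (le_abs_self c) ha)

theorem mem_or_mem_of_inf_eq_zero (hu : 0 ≤ u) {a b : V} (hab : a ⊓ b = 0) :
    a ∈ J ∨ b ∈ J := by
  by_contra! hno
  have ha : 0 ≤ a := hab ▸ inf_le_left
  have hb : 0 ≤ b := hab ▸ inf_le_right
  obtain ⟨j, hj, hj0, c, hc, hja⟩ := hJ.exists_le_add_smul ha hno.1
  obtain ⟨k, hk, hk0, d, hd, hkb⟩ := hJ.exists_le_add_smul hb hno.2
  refine hJ.notMem (mem_of_nonneg_of_le hJ.isSolid (J.add_mem hj hk) hu ?_)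
  calc u ≤ (j + k + c • a) ⊓ (j + k + d • b) := by
        refine le_inf (hja.trans ?_) (hkb.trans ?_)
        · exact add_le_add_left (le_add_of_nonneg_right hk0) _
        · exact add_le_add_left (le_add_of_nonneg_left hj0) _
    _ = j + k := by rw [← add_inf, inf_smul_eq_zero hab hc hd, add_zero]

theorem not_smul_le (hu : 0 ≤ u) {c : ℝ} (hc : 0 < c) {y : V} (hy : y ∈ J) : ¬ c • u ≤ y :=
  fun h => hJ.notMem <| (J.smul_mem_iff hc.ne').1 <|
    mem_of_nonneg_of_le hJ.isSolid hy (smul_nonneg hc.le hu) h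

theorem mem_of_forall_posPart_mem (hu : 0 ≤ u) {y : V}
    (h : ∀ ε : ℝ, 0 < ε → (|y| - ε • u)⁺ ∈ J) : y ∈ J := by
  by_contra hy
  have habs : |y| ∉ J := fun hmem => hy (hJ.isSolid hmem (abs_abs y).ge)
  obtain ⟨j, hj, -, c, hc, huj⟩ := hJ.exists_le_add_smul (abs_nonneg y) habs
  set ε : ℝ := (2 * (c + 1))⁻¹
  have hε : 0 < ε := by positivity
  have hcε : c * ε ≤ 1 / 2 := by
    rw [← div_eq_mul_inv, div_le_div_iff₀ (by positivity) two_pos]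
    linarith
  refine hJ.not_smul_le hu (show 0 < 1 - c * ε by linarith)
    (J.add_mem hj (J.smul_mem c (h ε hε))) ?_
  calc (1 - c * ε) • u = u - (c * ε) • u := by module
    _ ≤ (j + c • |y|) - (c * ε) • u := sub_le_sub_right huj _
    _ = j + c • (|y| - ε • u) := by module
    _ ≤ j + c • (|y| - ε • u)⁺ :=
      add_le_add_right (smul_le_smul_of_nonneg_left (le_posPart _) hc) _

theorem exists_sub_smul_mem (hu : 0 ≤ u) {x : V} (hx : x ∈ principalIdeal u) :
    ∃ t : ℝ, x - t • u ∈ J := by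
  obtain ⟨c, hc⟩ := mem_principalIdeal.1 hx
  have hxu : x ≤ c • u := (le_abs_self x).trans hc
  have hux : -(c • u) ≤ x := neg_le.1 ((neg_le_abs x).trans hc)
  set S : Set ℝ := {s | (x - s • u)⁺ ∈ J}
  have hne : S.Nonempty := ⟨c, by
    simp only [S, Set.mem_ofPred_eq, posPart_of_nonpos (sub_nonpos.2 hxu), J.zero_mem]⟩
  have hbdd : BddBelow S := by
    refine ⟨-c, fun s hs => ?_⟩
    by_contra! hlt
    refine hJ.not_smul_le hu (sub_pos.2 hlt) hs ?_
    calc (-c - s) • u = -(c • u) - s • u := by module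
      _ ≤ x - s • u := sub_le_sub_right hux _
      _ ≤ (x - s • u)⁺ := le_posPart _
  refine ⟨sInf S, hJ.mem_of_forall_posPart_mem hu fun ε hε => ?_⟩
  obtain ⟨s, hs, hlt⟩ := exists_lt_of_csInf_lt hne (lt_add_of_pos_right (sInf S) hε)
  have hnot : (x - (sInf S - ε) • u)⁺ ∉ J :=
    fun hmem => notMem_of_lt_csInf (sub_lt_self (sInf S) hε) hbdd hmem
  have hneg : (x - (sInf S - ε) • u)⁻ ∈ J :=
    (hJ.mem_or_mem_of_inf_eq_zero hu (posPart_inf_negPart_eq_zero _)).resolve_left hnot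
  refine mem_of_nonneg_of_le hJ.isSolid (J.add_mem hs hneg) (posPart_nonneg _) ?_
  refine sup_le (sub_le_iff_le_add.2 (abs_le'.2 ⟨?_, ?_⟩))
    (add_nonneg (posPart_nonneg _) (negPart_nonneg _))
  · calc x - sInf S • u = (x - s • u) + (s - sInf S) • u := by module
      _ ≤ ((x - s • u)⁺ + (x - (sInf S - ε) • u)⁻) + ε • u :=
        add_le_add ((le_posPart _).trans (le_add_of_nonneg_right (negPart_nonneg _)))
          (smul_le_smul_of_nonneg_right (by linarith) hu)
  · calc -(x - sInf S • u) = -(x - (sInf S - ε) • u) + ε • u := by module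
      _ ≤ ((x - s • u)⁺ + (x - (sInf S - ε) • u)⁻) + ε • u :=
        add_le_add_left ((neg_le_negPart _).trans (le_add_of_nonneg_left (posPart_nonneg _))) _

end IsMaximalAvoiding

end SolidSubspace

/-! ### Characters -/

section Characters

variable {V : Type*} [AddCommGroup V] [Lattice V] [IsOrderedAddMonoid V] [Module ℝ V]
  [IsOrderedModule ℝ V]

/-- A linear functional whose restriction to the principal ideal of `u` is a lattice homomorphism
into `ℝ` with value `1` at `u`. Outside the ideal its values carry no information. -/
structure IsCharacter (u : V) (ω : V →ₗ[ℝ] ℝ) : Prop where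
  map_unit : ω u = 1
  map_abs : ∀ x ∈ principalIdeal u, ω |x| = |ω x|

namespace IsCharacter

variable {u : V} {ω : V →ₗ[ℝ] ℝ} (hω : IsCharacter u ω) {x y : V}
include hω

theorem nonneg (hx : x ∈ principalIdeal u) (h : 0 ≤ x) : 0 ≤ ω x := by
  rw [← abs_of_nonneg h, hω.map_abs x hx]
  exact abs_nonneg _

theorem mono (hx : x ∈ principalIdeal u) (hy : y ∈ principalIdeal u) (h : x ≤ y) : ω x ≤ ω y := by
  rw [← sub_nonneg, ← map_sub]
  exact hω.nonneg (Submodule.sub_mem _ hy hx) (sub_nonneg.2 h)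

theorem map_sup (hx : x ∈ principalIdeal u) (hy : y ∈ principalIdeal u) :
    ω (x ⊔ y) = ω x ⊔ ω y := by
  rw [sup_eq_half_smul_add_add_abs_sub' ℝ x y, sup_eq_half_smul_add_add_abs_sub' ℝ (ω x) (ω y),
    map_smul, map_add, map_add, hω.map_abs _ (Submodule.sub_mem _ hy hx), map_sub]

theorem map_inf (hx : x ∈ principalIdeal u) (hy : y ∈ principalIdeal u) :
    ω (x ⊓ y) = ω x ⊓ ω y := by
  rw [inf_eq_half_smul_add_sub_abs_sub' ℝ x y, inf_eq_half_smul_add_sub_abs_sub' ℝ (ω x) (ω y),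
    map_smul, map_sub, map_add, hω.map_abs _ (Submodule.sub_mem _ hy hx), map_sub]

theorem map_posPart (hx : x ∈ principalIdeal u) : ω x⁺ = (ω x)⁺ := by
  rw [posPart_def, hω.map_sup hx (Submodule.zero_mem _), map_zero, posPart_def]

end IsCharacter

theorem IsMaximalAvoiding.exists_isCharacter {J : Submodule ℝ V} {u : V}
    (hJ : IsMaximalAvoiding J u) (hu : 0 ≤ u) :
    ∃ ω : V →ₗ[ℝ] ℝ, IsCharacter u ω ∧ ∀ x ∈ J, ω x = 0 := by
  obtain ⟨f, hfu, hJf⟩ := Submodule.exists_le_ker_of_notMem hJ.notMem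
  have hker (x : V) (hx : x ∈ J) : f x = 0 := LinearMap.mem_ker.1 (hJf hx)
  set ω : V →ₗ[ℝ] ℝ := (f u)⁻¹ • f
  have hωu : ω u = 1 := inv_mul_cancel₀ hfu
  have hωJ (x : V) (hx : x ∈ J) : ω x = 0 := by
    rw [LinearMap.smul_apply, hker x hx, smul_zero]
  have hval {x : V} {t : ℝ} (h : x - t • u ∈ J) : ω x = t := by
    have := hωJ _ h
    rwa [map_sub, map_smul, hωu, smul_eq_mul, mul_one, sub_eq_zero] at this
  refine ⟨ω, ⟨hωu, fun x hx => ?_⟩, hωJ⟩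
  obtain ⟨t, ht⟩ := hJ.exists_sub_smul_mem hu hx
  have habs : |x| - |t| • u ∈ J := by
    rw [← abs_smul_of_nonneg t hu]
    exact hJ.isSolid ht (abs_abs_sub_abs_le x (t • u))
  rw [hval ht, hval habs]

namespace IsArchimedean

variable (harch : IsArchimedean V) {u : V} (hu : 0 ≤ u) {x y : V}
include harch hu

theorem exists_isCharacter_pos (hy : y ∈ principalIdeal u) (hy0 : 0 ≤ y) (hne : y ≠ 0) :
    ∃ ω : V →ₗ[ℝ] ℝ, IsCharacter u ω ∧ 0 < ω y := by
  obtain ⟨n, hn⟩ : ∃ n : ℕ, ¬ n • y ≤ u := by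
    by_contra! h
    exact hne (harch y u hy0 hu h)
  set d := n • y - u with hd
  have hdu : d ∈ principalIdeal u :=
    Submodule.sub_mem _ (nsmul_mem hy n) (self_mem_principalIdeal hu)
  have hpos : d⁺ ≠ 0 := fun h => hn (sub_nonpos.1 (posPart_eq_zero.1 h))
  have hu_notMem : u ∉ principalIdeal d⁻ := fun h =>
    hpos <| eq_zero_of_mem_principalIdeal (posPart_inf_negPart_eq_zero d) <|
      principalIdeal_le (isSolid_principalIdeal _) h <|
        posPart_mem_of_isSolid (isSolid_principalIdeal u) hdu
  obtain ⟨J, hdJ, hJ⟩ := exists_isMaximalAvoiding (isSolid_principalIdeal _) hu_notMem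
  obtain ⟨ω, hω, hωJ⟩ := hJ.exists_isCharacter hu
  have hωd : 0 ≤ ω d := by
    rw [← posPart_sub_negPart d, map_sub,
      hωJ _ (hdJ (self_mem_principalIdeal (negPart_nonneg d))), sub_zero]
    exact hω.nonneg (posPart_mem_of_isSolid (isSolid_principalIdeal u) hdu) (posPart_nonneg d)
  have hωn : 1 ≤ n * ω y := by
    rwa [hd, map_sub, map_nsmul, hω.map_unit, sub_nonneg, nsmul_eq_mul] at hωd
  exact ⟨ω, hω, pos_of_mul_pos_right (zero_lt_one.trans_le hωn) n.cast_nonneg⟩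

theorem le_of_isCharacter (hx : x ∈ principalIdeal u) (hy : y ∈ principalIdeal u)
    (h : ∀ ω : V →ₗ[ℝ] ℝ, IsCharacter u ω → ω x ≤ ω y) : x ≤ y := by
  rw [← sub_nonpos, ← posPart_eq_zero]
  by_contra hne
  have hxy := Submodule.sub_mem _ hx hy
  obtain ⟨ω, hω, hpos⟩ := harch.exists_isCharacter_pos hu
    (posPart_mem_of_isSolid (isSolid_principalIdeal u) hxy) (posPart_nonneg _) hne
  rw [hω.map_posPart hxy, map_sub, posPart_of_nonpos (sub_nonpos.2 (h ω hω))] at hpos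
  exact hpos.false

theorem eq_of_isCharacter (hx : x ∈ principalIdeal u) (hy : y ∈ principalIdeal u)
    (h : ∀ ω : V →ₗ[ℝ] ℝ, IsCharacter u ω → ω x = ω y) : x = y :=
  le_antisymm (harch.le_of_isCharacter hu hx hy fun ω hω => (h ω hω).le)
    (harch.le_of_isCharacter hu hy hx fun ω hω => (h ω hω).ge)

end IsArchimedean

end Characters

/-! ### Functional calculus -/

section FunctionalCalculus

variable {V : Type*} [AddCommGroup V] [Lattice V] [IsOrderedAddMonoid V] [Module ℝ V]
  [IsOrderedModule ℝ V]

theorem IsCharacter.abs_map_le {u x : V} {ω : V →ₗ[ℝ] ℝ} (hω : IsCharacter u ω) (hu : 0 ≤ u)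
    {ε : ℝ} (h : |x| ≤ ε • u) : |ω x| ≤ ε := by
  have hx : x ∈ principalIdeal u := mem_principalIdeal.2 ⟨ε, h⟩
  calc |ω x| = ω |x| := (hω.map_abs x hx).symm
    _ ≤ ω (ε • u) := hω.mono (abs_mem_of_isSolid (isSolid_principalIdeal u) hx)
        (Submodule.smul_mem _ ε (self_mem_principalIdeal hu)) h
    _ = ε := by rw [map_smul, hω.map_unit, smul_eq_mul, mul_one]

theorem IsArchimedean.abs_le_smul_of_isCharacter (harch : IsArchimedean V) {u x : V} (hu : 0 ≤ u)
    (hx : x ∈ principalIdeal u) {ε : ℝ} (h : ∀ ω : V →ₗ[ℝ] ℝ, IsCharacter u ω → |ω x| ≤ ε) :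
    |x| ≤ ε • u := by
  refine harch.le_of_isCharacter hu (abs_mem_of_isSolid (isSolid_principalIdeal u) hx)
    (Submodule.smul_mem _ ε (self_mem_principalIdeal hu)) fun ω hω => ?_
  rw [hω.map_abs x hx, map_smul, hω.map_unit, smul_eq_mul, mul_one]
  exact h ω hω

theorem IsCharacter.tendsto {u l : V} {x : ℕ → V} {ω : V →ₗ[ℝ] ℝ} (hω : IsCharacter u ω)
    (hu : 0 ≤ u) (h : ∀ ε : ℝ, 0 < ε → ∃ N : ℕ, ∀ n ≥ N, |x n - l| ≤ ε • u) :
    Filter.Tendsto (fun n => ω (x n)) Filter.atTop (nhds (ω l)) := by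
  refine Metric.tendsto_atTop.2 fun ε hε => ?_
  obtain ⟨N, hN⟩ := h (ε / 2) (half_pos hε)
  refine ⟨N, fun n hn => ?_⟩
  rw [Real.dist_eq, ← map_sub]
  exact (hω.abs_map_le hu (hN n hn)).trans_lt (half_lt_self hε)

variable {X : Type*} [TopologicalSpace X] [CompactSpace X]

/-- The continuous functions on `X` that come from an element of the principal ideal of `e` when
the characters at `e` are regarded as points of `X` by means of `T`. -/
def representedFunctions (e : V) (T : {ω : V →ₗ[ℝ] ℝ // IsCharacter e ω} → X) : Set C(X, ℝ) :=
  {F | ∃ a ∈ principalIdeal e, ∀ ω, ω.1 a = F (T ω)}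

theorem isClosed_representedFunctions (harch : IsArchimedean V) (huc : IsUniformlyComplete V)
    {e : V} (he : 0 ≤ e) (T : {ω : V →ₗ[ℝ] ℝ // IsCharacter e ω} → X) :
    IsClosed (representedFunctions e T) := by
  refine isClosed_of_closure_subset fun F hF => ?_
  obtain ⟨G, hG, hlim⟩ := mem_closure_iff_seq_limit.1 hF
  choose a ha haG using hG
  have hcauchy (ε : ℝ) (hε : 0 < ε) : ∃ N : ℕ, ∀ m ≥ N, ∀ n ≥ N, |a m - a n| ≤ ε • e := by
    obtain ⟨N, hN⟩ := Metric.cauchySeq_iff.1 hlim.cauchySeq ε hε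
    refine ⟨N, fun m hm n hn => harch.abs_le_smul_of_isCharacter he
      (Submodule.sub_mem _ (ha m) (ha n)) fun ω hω => ?_⟩
    rw [map_sub, haG m ⟨ω, hω⟩, haG n ⟨ω, hω⟩, ← Real.dist_eq]
    exact (ContinuousMap.dist_apply_le_dist _).trans (hN m hm n hn).le
  obtain ⟨l, hl⟩ := huc e he a hcauchy
  have hle : l ∈ principalIdeal e := by
    obtain ⟨N, hN⟩ := hl 1 one_pos
    rw [← sub_sub_cancel (a N) l]
    exact Submodule.sub_mem _ (ha N) (mem_principalIdeal.2 ⟨1, hN N le_rfl⟩)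
  refine ⟨l, hle, fun ω => tendsto_nhds_unique (ω.2.tendsto he hl) ?_⟩
  simp only [haG]
  exact ((continuous_eval_const (T ω)).tendsto F).comp hlim

theorem representedFunctions_eq_univ (harch : IsArchimedean V) (huc : IsUniformlyComplete V)
    {e : V} (he : 0 ≤ e) {T : {ω : V →ₗ[ℝ] ℝ // IsCharacter e ω} → X}
    (hT : (representedFunctions e T).SeparatesPointsStrongly) :
    representedFunctions e T = Set.univ := by
  rw [← (isClosed_representedFunctions harch huc he T).closure_eq]
  refine ContinuousMap.sublattice_closure_eq_top _ ?_ ?_ ?_ hT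
  · exact ⟨0, 0, Submodule.zero_mem _, fun ω => by rw [map_zero, ContinuousMap.zero_apply]⟩
  · rintro F ⟨a, ha, haF⟩ G ⟨b, hb, hbG⟩
    exact ⟨a ⊓ b, inf_mem_of_isSolid (isSolid_principalIdeal e) ha hb, fun ω => by
      rw [ω.2.map_inf ha hb, haF, hbG, ContinuousMap.inf_apply]⟩
  · rintro F ⟨a, ha, haF⟩ G ⟨b, hb, hbG⟩
    exact ⟨a ⊔ b, sup_mem_of_isSolid (isSolid_principalIdeal e) ha hb, fun ω => by
      rw [ω.2.map_sup ha hb, haF, hbG, ContinuousMap.sup_apply]⟩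

theorem exists_forall_isCharacter_apply_eq (harch : IsArchimedean V) (huc : IsUniformlyComplete V)
    {ι : Type*} {e : V} (he : 0 ≤ e) {g : ι → V} (hg : ∀ i, g i ∈ principalIdeal e)
    {F : (ι → ℝ) → ℝ} (hF : Continuous F) :
    ∃ a ∈ principalIdeal e, ∀ ω : V →ₗ[ℝ] ℝ, IsCharacter e ω → ω a = F fun i => ω (g i) := by
  choose c hc using fun i => mem_principalIdeal.1 (hg i)
  let T (ω : {ω : V →ₗ[ℝ] ℝ // IsCharacter e ω}) (i : ι) : Set.Icc (-c i) (c i) :=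
    ⟨ω.1 (g i), abs_le.1 (ω.2.abs_map_le he (hc i))⟩
  have hee := self_mem_principalIdeal he
  have hconst (b : ℝ) : ContinuousMap.const _ b ∈ representedFunctions e T :=
    ⟨b • e, Submodule.smul_mem _ b hee, fun ω => by simp [ω.2.map_unit]⟩
  have haffine (i : ι) (b d : ℝ) :
      (⟨fun t => b + d * (t i : ℝ), by fun_prop⟩ : C((i : ι) → Set.Icc (-c i) (c i), ℝ)) ∈
        representedFunctions e T :=
    ⟨b • e + d • g i, Submodule.add_mem _ (Submodule.smul_mem _ b hee)
      (Submodule.smul_mem _ d (hg i)), fun ω => by simp [T, ω.2.map_unit]⟩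
  have hsep : (representedFunctions e T).SeparatesPointsStrongly := by
    intro v x y
    rcases eq_or_ne x y with rfl | hxy
    · exact ⟨_, hconst (v x), rfl, rfl⟩
    · obtain ⟨i, hi⟩ := Function.ne_iff.1 hxy
      have hne : (y i : ℝ) - x i ≠ 0 := sub_ne_zero.2 fun h => hi (Subtype.ext h.symm)
      set d := (v y - v x) / (y i - x i)
      refine ⟨_, haffine i (v x - d * x i) d, sub_add_cancel _ _, ?_⟩
      calc v x - d * x i + d * y i = v x + d * (y i - x i) := by ring
        _ = v y := by rw [div_mul_cancel₀ _ hne, add_sub_cancel]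
  obtain ⟨a, ha, haF⟩ : (⟨fun t => F fun i => (t i : ℝ), by fun_prop⟩ :
      C((i : ι) → Set.Icc (-c i) (c i), ℝ)) ∈ representedFunctions e T := by
    rw [representedFunctions_eq_univ harch huc he hsep]
    exact Set.mem_univ _
  exact ⟨a, ha, fun ω hω => haF ⟨ω, hω⟩⟩

end FunctionalCalculus

/-! ### Multiplication in `f`-algebras -/

section Multiplication

variable {A : Type*} [NonUnitalRing A]

theorem prod_succ_succ (p : ℕ) (g : Fin (p + 2) → A) :
    prod (p + 2) g = prod (p + 1) (fun i => g i.castSucc) * g (Fin.last (p + 1)) := rfl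

theorem power_succ_succ (a : A) (p : ℕ) : power a (p + 2) = power a (p + 1) * a := rfl

theorem power_smul [Module ℝ A] [IsScalarTower ℝ A A] [SMulCommClass ℝ A A] (c : ℝ)
    (a : A) (p : ℕ) : power (c • a) p = c ^ p • power a p := by
  induction p using Nat.twoStepInduction with
  | zero => exact (smul_zero _).symm
  | one => rw [pow_one]; rfl
  | more p _ ih => rw [power_succ_succ, ih, power_succ_succ, smul_mul_smul_comm, ← pow_succ]

variable [Lattice A]

namespace IsFAlgebra

variable (hf : IsFAlgebra A) {a b c d : A}
include hf

theorem inf_mul_right_eq_zero (h : a ⊓ b = 0) (hc : 0 ≤ c) : a ⊓ b * c = 0 := by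
  rw [inf_comm] at h ⊢
  exact (hf.mul_inf_eq_zero b a c h hc).1

theorem inf_mul_left_eq_zero (h : a ⊓ b = 0) (hc : 0 ≤ c) : a ⊓ c * b = 0 := by
  rw [inf_comm] at h ⊢
  exact (hf.mul_inf_eq_zero b a c h hc).2

theorem mul_eq_zero_of_inf_eq_zero (h : a ⊓ b = 0) : a * b = 0 := by
  have ha : 0 ≤ a := h ▸ inf_le_left
  have hb : 0 ≤ b := h ▸ inf_le_right
  have hab : a * b ⊓ a * b = 0 :=
    hf.inf_mul_left_eq_zero (hf.mul_inf_eq_zero a b b h hb).1 ha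
  rwa [inf_idem] at hab

theorem prod_nonneg {p : ℕ} {g : Fin p → A} (hg : ∀ i, 0 ≤ g i) : 0 ≤ prod p g := by
  induction p using Nat.twoStepInduction with
  | zero => exact le_rfl
  | one => exact hg 0
  | more p _ ih => exact hf.mul_nonneg _ _ (ih fun i => hg _) (hg _)

theorem power_nonneg (ha : 0 ≤ a) (p : ℕ) : 0 ≤ power a p :=
  hf.prod_nonneg fun _ => ha

theorem inf_power_eq_zero (h : a ⊓ b = 0) (p : ℕ) : a ⊓ power b p = 0 := by
  have ha : 0 ≤ a := h ▸ inf_le_left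
  induction p using Nat.twoStepInduction with
  | zero => exact inf_eq_right.2 ha
  | one => exact h
  | more p _ ih => exact hf.inf_mul_right_eq_zero ih (h ▸ inf_le_right)

variable [IsOrderedAddMonoid A]

theorem mul_le_mul_of_nonneg_right (h : a ≤ b) (hc : 0 ≤ c) : a * c ≤ b * c := by
  rw [← sub_nonneg, ← sub_mul]
  exact hf.mul_nonneg _ _ (sub_nonneg.2 h) hc

theorem mul_le_mul (hab : a ≤ b) (hcd : c ≤ d) (hc : 0 ≤ c) (hb : 0 ≤ b) : a * c ≤ b * d := by
  refine (hf.mul_le_mul_of_nonneg_right hab hc).trans ?_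
  rw [← sub_nonneg, ← mul_sub]
  exact hf.mul_nonneg _ _ hb (sub_nonneg.2 hcd)

theorem abs_mul_of_nonneg_left (ha : 0 ≤ a) (b : A) : |a * b| = a * |b| := by
  have hpos := hf.mul_nonneg _ _ ha (posPart_nonneg b)
  have hneg := hf.mul_nonneg _ _ ha (negPart_nonneg b)
  have hdisj : a * b⁺ ⊓ a * b⁻ = 0 := hf.inf_mul_left_eq_zero
    (hf.mul_inf_eq_zero _ _ a (posPart_inf_negPart_eq_zero b) ha).2 ha
  calc |a * b| = |a * b⁺ - a * b⁻| := by rw [← mul_sub, posPart_sub_negPart]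
    _ = |a * b⁺| + |a * b⁻| := by
      refine abs_sub_eq_add_of_abs_inf_abs_eq_zero ?_
      rw [abs_of_nonneg hpos, abs_of_nonneg hneg, hdisj]
    _ = a * |b| := by
      rw [abs_of_nonneg hpos, abs_of_nonneg hneg, ← mul_add, posPart_add_negPart]

theorem abs_mul (a b : A) : |a * b| = |a| * |b| := by
  have hdisj : a⁺ * |b| ⊓ a⁻ * |b| = 0 := hf.inf_mul_right_eq_zero
    (hf.mul_inf_eq_zero _ _ |b| (posPart_inf_negPart_eq_zero a) (abs_nonneg b)).1 (abs_nonneg b)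
  calc |a * b| = |a⁺ * b - a⁻ * b| := by rw [← sub_mul, posPart_sub_negPart]
    _ = |a⁺ * b| + |a⁻ * b| := by
      refine abs_sub_eq_add_of_abs_inf_abs_eq_zero ?_
      rw [hf.abs_mul_of_nonneg_left (posPart_nonneg a),
        hf.abs_mul_of_nonneg_left (negPart_nonneg a), hdisj]
    _ = |a| * |b| := by
      rw [hf.abs_mul_of_nonneg_left (posPart_nonneg a),
        hf.abs_mul_of_nonneg_left (negPart_nonneg a), ← add_mul, posPart_add_negPart]

theorem prod_mono {p : ℕ} {g h : Fin p → A} (hg : ∀ i, 0 ≤ g i) (hgh : ∀ i, g i ≤ h i) :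
    prod p g ≤ prod p h := by
  induction p using Nat.twoStepInduction with
  | zero => exact le_rfl
  | one => exact hgh 0
  | more p _ ih =>
    exact hf.mul_le_mul (ih (fun i => hg _) fun i => hgh _) (hgh _) (hg _)
      (hf.prod_nonneg fun i => (hg _).trans (hgh _))

theorem power_mono (ha : 0 ≤ a) (h : a ≤ b) (p : ℕ) : power a p ≤ power b p :=
  hf.prod_mono (fun _ => ha) fun _ => h

theorem abs_prod {p : ℕ} (g : Fin p → A) : |prod p g| = prod p fun i => |g i| := by
  induction p using Nat.twoStepInduction with
  | zero => exact abs_zero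
  | one => rfl
  | more p _ ih => rw [prod_succ_succ, hf.abs_mul, ih, prod_succ_succ]

theorem abs_power (a : A) (p : ℕ) : |power a p| = power |a| p :=
  hf.abs_prod _

theorem inf_power_sub_power_eq_zero (ha : 0 ≤ a) (hab : a ≤ b) (h : c ⊓ (b - a) = 0) (p : ℕ) :
    c ⊓ (power b p - power a p) = 0 := by
  induction p using Nat.twoStepInduction with
  | zero =>
    rw [show power b 0 - power a 0 = 0 from sub_self 0]
    exact inf_eq_right.2 (h ▸ inf_le_left)
  | one => exact h
  | more p _ ih =>
    have hstep : power b (p + 2) - power a (p + 2) =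
        (power b (p + 1) - power a (p + 1)) * b + power a (p + 1) * (b - a) := by
      rw [power_succ_succ, power_succ_succ]
      noncomm_ring
    rw [hstep]
    exact inf_add_eq_zero (hf.inf_mul_right_eq_zero ih (ha.trans hab))
      (hf.inf_mul_left_eq_zero h (hf.power_nonneg ha _))

theorem power_inf (ha : 0 ≤ a) (hb : 0 ≤ b) (p : ℕ) :
    power (a ⊓ b) p = power a p ⊓ power b p := by
  have hm : 0 ≤ a ⊓ b := le_inf ha hb
  have hdisj : (b - a ⊓ b) ⊓ (a - a ⊓ b) = 0 := by rw [← inf_sub, inf_comm, sub_self]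
  have hleft := hf.inf_power_sub_power_eq_zero hm inf_le_left hdisj p
  rw [inf_comm] at hleft
  have hright := hf.inf_power_sub_power_eq_zero hm inf_le_right hleft p
  rw [← inf_sub, sub_eq_zero] at hright
  exact hright.symm

theorem power_add_power_le (ha : 0 ≤ a) (hb : 0 ≤ b) (p : ℕ) :
    power a p + power b p ≤ power (a + b) p := by
  induction p using Nat.twoStepInduction with
  | zero => exact (add_zero 0).le
  | one => exact le_rfl
  | more p _ ih =>
    have hcross : 0 ≤ power a (p + 1) * b + power b (p + 1) * a :=
      add_nonneg (hf.mul_nonneg _ _ (hf.power_nonneg ha _) hb)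
        (hf.mul_nonneg _ _ (hf.power_nonneg hb _) ha)
    calc power a (p + 2) + power b (p + 2)
        ≤ power a (p + 2) + power b (p + 2) + (power a (p + 1) * b + power b (p + 1) * a) :=
          le_add_of_nonneg_right hcross
      _ = (power a (p + 1) + power b (p + 1)) * (a + b) := by
          rw [power_succ_succ, power_succ_succ]
          noncomm_ring
      _ ≤ power (a + b) (p + 2) := hf.mul_le_mul_of_nonneg_right ih (add_nonneg ha hb)

theorem le_of_power_le (hs : IsSemiprime A) (ha : 0 ≤ a) (hb : 0 ≤ b) {p : ℕ} (hp : p ≠ 0)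
    (h : power a p ≤ power b p) : a ≤ b := by
  have hd : 0 ≤ a - a ⊓ b := sub_nonneg.2 inf_le_left
  have hle := hf.power_add_power_le hd (le_inf ha hb) p
  rw [sub_add_cancel, hf.power_inf ha hb, inf_eq_left.2 h, add_le_iff_nonpos_left] at hle
  have hzero : a - a ⊓ b = 0 :=
    hs _ ⟨p, Nat.one_le_iff_ne_zero.2 hp, hle.antisymm (hf.power_nonneg hd p)⟩
  exact inf_eq_left.1 (sub_eq_zero.1 hzero).symm

end IsFAlgebra

section Module

variable [IsOrderedAddMonoid A] [Module ℝ A] [IsOrderedModule ℝ A] [IsScalarTower ℝ A A]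
  [SMulCommClass ℝ A A]

theorem IsFAlgebra.mul_mem_principalIdeal (hf : IsFAlgebra A) {u v x y : A} (hu : 0 ≤ u)
    (hx : x ∈ principalIdeal u) (hy : y ∈ principalIdeal v) : x * y ∈ principalIdeal (u * v) := by
  obtain ⟨c, hc⟩ := mem_principalIdeal.1 hx
  obtain ⟨d, hd⟩ := mem_principalIdeal.1 hy
  refine mem_principalIdeal.2 ⟨|c| * d, ?_⟩
  rw [hf.abs_mul, ← smul_mul_smul_comm]
  exact hf.mul_le_mul (hc.trans (smul_le_smul_of_nonneg_right (le_abs_self c) hu)) hd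
    (abs_nonneg y) (smul_nonneg (abs_nonneg c) hu)

theorem IsFAlgebra.prod_mem_principalIdeal (hf : IsFAlgebra A) {e : A} (he : 0 ≤ e) {p : ℕ}
    {g : Fin p → A} (hg : ∀ i, g i ∈ principalIdeal e) :
    prod p g ∈ principalIdeal (power e p) := by
  induction p using Nat.twoStepInduction with
  | zero => exact Submodule.zero_mem _
  | one => exact hg 0
  | more p _ ih =>
    exact hf.mul_mem_principalIdeal (hf.power_nonneg he _) (ih fun i => hg _) (hg _)

end Module

end Multiplication

/-! ### Characters and products -/

section CharactersAndProducts

variable {V : Type*} [AddCommGroup V] [Lattice V] [IsOrderedAddMonoid V] [Module ℝ V]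
  [IsOrderedModule ℝ V]

theorem IsCharacter.eq_mul_of_abs_le_mul {u x : V} {χ ψ : V →ₗ[ℝ] ℝ} (hχ : IsCharacter u χ)
    (hu : 0 ≤ u) {c : ℝ} (h : ∀ y ∈ principalIdeal u, |ψ y| ≤ c * |χ y|)
    (hx : x ∈ principalIdeal u) : ψ x = ψ u * χ x := by
  have hmem : x - χ x • u ∈ principalIdeal u :=
    Submodule.sub_mem _ hx (Submodule.smul_mem _ _ (self_mem_principalIdeal hu))
  have hχ0 : χ (x - χ x • u) = 0 := by
    rw [map_sub, map_smul, hχ.map_unit, smul_eq_mul, mul_one, sub_self]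
  have hψ0 := h _ hmem
  rw [hχ0, abs_zero, mul_zero, abs_nonpos_iff, map_sub, map_smul, smul_eq_mul, sub_eq_zero] at hψ0
  rw [hψ0, mul_comm]

theorem IsCharacter.le_of_disjoint {u z : V} {χ ψ : V →ₗ[ℝ] ℝ} (hχ : IsCharacter u χ)
    (hψ : IsCharacter u ψ) (hu : 0 ≤ u)
    (h : ∀ x ∈ principalIdeal u, ∀ y ∈ principalIdeal u, x ⊓ y = 0 → χ x = 0 ∨ ψ y = 0)
    (hz : z ∈ principalIdeal u) : ψ z ≤ χ z := by
  by_contra! hlt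
  obtain ⟨t, hχt, hψt⟩ := exists_between hlt
  have hsmul : t • u ∈ principalIdeal u := Submodule.smul_mem _ t (self_mem_principalIdeal hu)
  have hx := Submodule.sub_mem _ hsmul hz
  have hy := Submodule.sub_mem _ hz hsmul
  have hsolid := isSolid_principalIdeal u
  have hdisj : (t • u - z)⁺ ⊓ (z - t • u)⁺ = 0 := by
    rw [← neg_sub z, posPart_neg, inf_comm, posPart_inf_negPart_eq_zero]
  rcases h _ (posPart_mem_of_isSolid hsolid hx) _ (posPart_mem_of_isSolid hsolid hy) hdisj with
    h0 | h0
  · rw [hχ.map_posPart hx, map_sub, map_smul, hχ.map_unit, smul_eq_mul, mul_one,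
      posPart_eq_zero] at h0
    linarith
  · rw [hψ.map_posPart hy, map_sub, map_smul, hψ.map_unit, smul_eq_mul, mul_one,
      posPart_eq_zero] at h0
    linarith

theorem IsCharacter.eq_of_disjoint {u z : V} {χ ψ : V →ₗ[ℝ] ℝ} (hχ : IsCharacter u χ)
    (hψ : IsCharacter u ψ) (hu : 0 ≤ u)
    (h : ∀ x ∈ principalIdeal u, ∀ y ∈ principalIdeal u, x ⊓ y = 0 → χ x = 0 ∨ ψ y = 0)
    (hz : z ∈ principalIdeal u) : χ z = ψ z := by
  refine le_antisymm ?_ (hχ.le_of_disjoint hψ hu h hz)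
  have hneg := hχ.le_of_disjoint hψ hu h (Submodule.neg_mem _ hz)
  rwa [map_neg, map_neg, neg_le_neg_iff] at hneg

variable {A : Type*} [NonUnitalRing A] [Lattice A] [IsOrderedAddMonoid A] [Module ℝ A]
  [IsOrderedModule ℝ A] [IsScalarTower ℝ A A] [SMulCommClass ℝ A A]

namespace IsCharacter

variable (hf : IsFAlgebra A) {u v : A} (hu : 0 ≤ u) {ω : A →ₗ[ℝ] ℝ}
  (hω : IsCharacter (u * v) ω)
include hf hu hω

theorem comp_mulLeft : IsCharacter v (ω ∘ₗ LinearMap.mulLeft ℝ u) where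
  map_unit := hω.map_unit
  map_abs y hy := by
    have huy := hf.mul_mem_principalIdeal hu (self_mem_principalIdeal hu) hy
    calc ω (u * |y|) = ω |u * y| := by rw [hf.abs_mul, abs_of_nonneg hu]
      _ = |ω (u * y)| := hω.map_abs _ huy

variable (hv : 0 ≤ v)
include hv

theorem comp_mulRight : IsCharacter u (ω ∘ₗ LinearMap.mulRight ℝ v) where
  map_unit := hω.map_unit
  map_abs x hx := by
    have hxv := hf.mul_mem_principalIdeal hu hx (self_mem_principalIdeal hv)
    calc ω (|x| * v) = ω |x * v| := by rw [hf.abs_mul, abs_of_nonneg hv]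
      _ = |ω (x * v)| := hω.map_abs _ hxv

theorem map_mul {x y : A} (hx : x ∈ principalIdeal u) (hy : y ∈ principalIdeal v) :
    ω (x * y) = ω (x * v) * ω (u * y) := by
  obtain ⟨c, hc⟩ := mem_principalIdeal.1 hx
  refine (hω.comp_mulLeft hf hu).eq_mul_of_abs_le_mul (ψ := ω ∘ₗ LinearMap.mulLeft ℝ x)
    (c := c) hv (fun z hz => ?_) hy
  have hsolid := isSolid_principalIdeal (u * v)
  have hxz := hf.mul_mem_principalIdeal hu hx hz
  have huz := hf.mul_mem_principalIdeal hu (self_mem_principalIdeal hu) hz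
  calc |ω (x * z)| = ω |x * z| := (hω.map_abs _ hxz).symm
    _ ≤ ω (c • |u * z|) := by
      refine hω.mono (abs_mem_of_isSolid hsolid hxz)
        (Submodule.smul_mem _ c (abs_mem_of_isSolid hsolid huz)) ?_
      rw [hf.abs_mul, hf.abs_mul, abs_of_nonneg hu, ← smul_mul_assoc]
      exact hf.mul_le_mul_of_nonneg_right hc (abs_nonneg z)
    _ = c * |ω (u * z)| := by rw [map_smul, hω.map_abs _ huz, smul_eq_mul]

end IsCharacter

theorem IsCharacter.exists_map_prod (hf : IsFAlgebra A) {e : A} (he : 0 ≤ e) {p : ℕ}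
    {ω : A →ₗ[ℝ] ℝ} (hω : IsCharacter (power e p) ω) :
    ∃ χ : A →ₗ[ℝ] ℝ, IsCharacter e χ ∧
      ∀ g : Fin p → A, (∀ i, g i ∈ principalIdeal e) → ω (prod p g) = ∏ i, χ (g i) := by
  induction p using Nat.twoStepInduction generalizing ω with
  | zero => exact absurd ((map_zero ω).symm.trans hω.map_unit) zero_ne_one
  | one => exact ⟨ω, hω, fun g _ => (Fin.prod_univ_one fun i => ω (g i)).symm⟩
  | more p _ ih =>
    set u := power e (p + 1)
    have hu : 0 ≤ u := hf.power_nonneg he (p + 1)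
    have hω' : IsCharacter (u * e) ω := hω
    obtain ⟨χ, hχ, hprod⟩ := ih (hω'.comp_mulRight hf hu he)
    set ψ := ω ∘ₗ LinearMap.mulLeft ℝ u
    have hψ : IsCharacter e ψ := hω'.comp_mulLeft hf hu
    have hmul (g : Fin (p + 1) → A) (hg : ∀ i, g i ∈ principalIdeal e) (y : A)
        (hy : y ∈ principalIdeal e) : ω (prod (p + 1) g * y) = (∏ i, χ (g i)) * ψ y := by
      rw [← hprod g hg]
      exact hω'.map_mul hf hu he (hf.prod_mem_principalIdeal he hg) hy
    have hχψ {y : A} (hy : y ∈ principalIdeal e) : χ y = ψ y := by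
      refine hχ.eq_of_disjoint hψ he (fun x hx y hy hxy => ?_) hy
      have hzero : power x (p + 1) * y = 0 := by
        refine hf.mul_eq_zero_of_inf_eq_zero ?_
        rw [inf_comm] at hxy ⊢
        exact hf.inf_power_eq_zero hxy (p + 1)
      have hχψ0 := hmul (fun _ => x) (fun _ => hx) y hy
      rw [← power, hzero, map_zero, Finset.prod_const] at hχψ0
      exact (mul_eq_zero.1 hχψ0.symm).imp_left eq_zero_of_pow_eq_zero
    refine ⟨χ, hχ, fun g hg => ?_⟩
    rw [prod_succ_succ, hmul _ (fun i => hg _) _ (hg _), ← hχψ (hg _),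
      Fin.prod_univ_castSucc fun i => χ (g i)]

theorem IsFAlgebra.exists_root (hf : IsFAlgebra A) (harch : IsArchimedean A)
    (huc : IsUniformlyComplete A) {p : ℕ} (hp : p ≠ 0) {g : Fin p → A} (hg : ∀ i, 0 ≤ g i) :
    ∃ r, 0 ≤ r ∧ r ≤ ∑ i, g i ∧ power r p = prod p g := by
  set e := ∑ i, g i
  have he : 0 ≤ e := Finset.sum_nonneg fun i _ => hg i
  have hge (i : Fin p) : g i ≤ e :=
    Finset.single_le_sum (f := g) (fun j _ => hg j) (Finset.mem_univ i)
  have hee := self_mem_principalIdeal he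
  have hmem (i : Fin p) : g i ∈ principalIdeal e :=
    mem_of_nonneg_of_le (isSolid_principalIdeal e) hee (hg i) (hge i)
  obtain ⟨r, hr, hrχ⟩ := exists_forall_isCharacter_apply_eq harch huc he hmem
    (F := fun t => (∏ i, t i) ^ (p⁻¹ : ℝ))
    (Continuous.rpow_const (by fun_prop) fun t => Or.inr (by positivity))
  have hχ0 {χ : A →ₗ[ℝ] ℝ} (hχ : IsCharacter e χ) (i : Fin p) : 0 ≤ χ (g i) :=
    hχ.nonneg (hmem i) (hg i)
  have hχ1 {χ : A →ₗ[ℝ] ℝ} (hχ : IsCharacter e χ) (i : Fin p) : χ (g i) ≤ 1 :=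
    hχ.map_unit ▸ hχ.mono (hmem i) hee (hge i)
  refine ⟨r, ?_, ?_, ?_⟩
  · refine harch.le_of_isCharacter he (Submodule.zero_mem _) hr fun χ hχ => ?_
    rw [map_zero, hrχ χ hχ]
    exact Real.rpow_nonneg (Finset.prod_nonneg fun i _ => hχ0 hχ i) _
  · refine harch.le_of_isCharacter he hr hee fun χ hχ => ?_
    rw [hrχ χ hχ, hχ.map_unit]
    exact Real.rpow_le_one (Finset.prod_nonneg fun i _ => hχ0 hχ i)
      (Finset.prod_le_one (fun i _ => hχ0 hχ i) fun i _ => hχ1 hχ i) (by positivity)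
  · refine harch.eq_of_isCharacter (hf.power_nonneg he p)
      (hf.prod_mem_principalIdeal he fun _ => hr) (hf.prod_mem_principalIdeal he hmem)
      fun ω hω => ?_
    obtain ⟨χ, hχ, hprod⟩ := hω.exists_map_prod hf he
    rw [power, hprod _ fun _ => hr, hprod _ hmem, Finset.prod_const, Finset.card_fin, hrχ χ hχ]
    exact Real.rpow_inv_natCast_pow (Finset.prod_nonneg fun i _ => hχ0 hχ i) hp

end CharactersAndProducts

/-! ### Finite elements -/

section FiniteElements

variable {V : Type*} [AddCommGroup V] [Lattice V] [IsOrderedAddMonoid V]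

theorem IsArchimedean.posPart_sub_inf_eq_zero (harch : IsArchimedean V) {y r w : V} (hy : 0 ≤ y)
    (hr : 0 ≤ r) (h : ∀ n : ℕ, y ⊓ n • r ≤ w) : (y - w)⁺ ⊓ r = 0 :=
  harch _ y (le_inf (posPart_nonneg _) hr) hy (nsmul_inf_le_of_forall_inf_nsmul_le hy h)

variable [Module ℝ V]

theorem mem_finiteElements_of_abs_le {φ ψ : V} (hψ : ψ ∈ finiteElements V) (h : |φ| ≤ |ψ|) :
    φ ∈ finiteElements V := by
  obtain ⟨z, hz, hmaj⟩ := hψ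
  refine ⟨z, hz, fun x => ?_⟩
  obtain ⟨c, hc, hn⟩ := hmaj x
  exact ⟨c, hc, fun n => (inf_le_inf_left _ (nsmul_le_nsmul_right h n)).trans (hn n)⟩

theorem zero_mem_finiteElements : (0 : V) ∈ finiteElements V :=
  ⟨0, le_rfl, fun x => ⟨1, one_pos, fun n => by simp⟩⟩

variable [IsOrderedModule ℝ V]

theorem add_mem_finiteElements {φ ψ : V} (hφ : φ ∈ finiteElements V)
    (hψ : ψ ∈ finiteElements V) : φ + ψ ∈ finiteElements V := by
  obtain ⟨y, hy, hφ⟩ := hφ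
  obtain ⟨z, hz, hψ⟩ := hψ
  refine ⟨y + z, add_nonneg hy hz, fun x => ?_⟩
  obtain ⟨c, hc, hcn⟩ := hφ x
  obtain ⟨d, hd, hdn⟩ := hψ x
  refine ⟨c + d, add_pos hc hd, fun n => ?_⟩
  calc |x| ⊓ n • |φ + ψ| ≤ |x| ⊓ (n • |φ| + n • |ψ|) := by
        rw [← nsmul_add]
        exact inf_le_inf_left _ (nsmul_le_nsmul_right (abs_add_le φ ψ) n)
    _ ≤ |x| ⊓ n • |φ| + |x| ⊓ n • |ψ| := inf_add_le_inf_add_inf (abs_nonneg x)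
        (nsmul_nonneg (abs_nonneg φ) n) (nsmul_nonneg (abs_nonneg ψ) n)
    _ ≤ c • y + d • z := add_le_add (hcn n) (hdn n)
    _ ≤ (c + d) • y + (c + d) • z := add_le_add
        (smul_le_smul_of_nonneg_right (le_add_of_nonneg_right hd.le) hy)
        (smul_le_smul_of_nonneg_right (le_add_of_nonneg_left hc.le) hz)
    _ = (c + d) • (y + z) := (smul_add _ _ _).symm

theorem sum_mem_finiteElements {ι : Type*} (s : Finset ι) (f : ι → V)
    (h : ∀ i ∈ s, f i ∈ finiteElements V) : ∑ i ∈ s, f i ∈ finiteElements V :=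
  Finset.sum_induction f (· ∈ finiteElements V) (fun _ _ => add_mem_finiteElements)
    zero_mem_finiteElements h

-- As `V` is Archimedean, the hypothesis `h` says that `φ` lies in the band generated by `r`.
theorem mem_finiteElements_of_disjoint_imp (harch : IsArchimedean V) {φ r : V}
    (hr : r ∈ finiteElements V) (h : ∀ w : V, w ⊓ |r| = 0 → w ⊓ |φ| = 0) :
    φ ∈ finiteElements V := by
  obtain ⟨z, hz, hmaj⟩ := hr
  refine ⟨z, hz, fun x => ?_⟩
  obtain ⟨c, hc, hcn⟩ := hmaj x
  refine ⟨c, hc, fun n => ?_⟩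
  set y := |x| ⊓ n • |φ|
  have hy : 0 ≤ y := le_inf (abs_nonneg x) (nsmul_nonneg (abs_nonneg φ) n)
  have hdisj : (y - c • z)⁺ ⊓ n • |φ| = 0 := by
    refine inf_nsmul_eq_zero (h _ ?_) n
    exact harch.posPart_sub_inf_eq_zero hy (abs_nonneg r)
      fun k => (inf_le_inf_right _ inf_le_left).trans (hcn k)
  have hle : (y - c • z)⁺ ≤ n • |φ| :=
    (sup_le (sub_le_self y (smul_nonneg hc.le hz)) hy).trans inf_le_right
  rw [inf_eq_left.2 hle] at hdisj
  exact sub_nonpos.1 (posPart_eq_zero.1 hdisj)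

end FiniteElements

/-! ### Sublattices -/

section Sublattice

variable {V : Type*} [Lattice V] {S : Set V}

theorem isInfIn_inf {a b : V} (h : a ⊓ b ∈ S) : IsInfIn S a b (a ⊓ b) :=
  ⟨h, inf_le_left, inf_le_right, fun _ _ h₁ h₂ => le_inf h₁ h₂⟩

variable [AddCommGroup V]

theorem IsModulusIn.abs_le {x m : V} (h : IsModulusIn S x m) : |x| ≤ m :=
  abs_le'.2 ⟨h.2.1, h.2.2.1⟩

theorem isModulusIn_abs {x : V} (h : |x| ∈ S) : IsModulusIn S x |x| :=
  ⟨h, le_abs_self x, neg_le_abs x, fun _ _ h₁ h₂ => abs_le'.2 ⟨h₁, h₂⟩⟩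

theorem isMajorantIn_iff [IsOrderedAddMonoid V] [Module ℝ V] (habs : ∀ x ∈ S, |x| ∈ S)
    (hinf : ∀ x ∈ S, ∀ y ∈ S, 0 ≤ x → 0 ≤ y → x ⊓ y ∈ S)
    (hsmul : ∀ x ∈ S, 0 ≤ x → ∀ n : ℕ, n • x ∈ S) {φ z : V} (hφ : φ ∈ S) :
    IsMajorantIn S φ z ↔
      z ∈ S ∧ 0 ≤ z ∧ ∀ x ∈ S, ∃ c : ℝ, 0 < c ∧ ∀ n : ℕ, |x| ⊓ n • |φ| ≤ c • z := by
  have hmem {x : V} (hx : x ∈ S) (n : ℕ) : |x| ⊓ n • |φ| ∈ S :=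
    hinf _ (habs x hx) _ (hsmul _ (habs φ hφ) (abs_nonneg φ) n) (abs_nonneg x)
      (nsmul_nonneg (abs_nonneg φ) n)
  refine and_congr_right fun _ => and_congr_right fun _ => forall₂_congr fun x hx =>
    exists_congr fun c => and_congr_right fun _ => forall_congr' fun n => ⟨?_, fun h => ?_⟩
  · rintro ⟨a, m, w, ha, hm, ⟨-, -, -, hw⟩, hle⟩
    refine (hw _ (hmem hx n) ?_ ?_).trans hle
    · exact inf_le_left.trans ha.abs_le
    · exact inf_le_right.trans (nsmul_le_nsmul_right hm.abs_le n)
  · exact ⟨|x|, |φ|, _, isModulusIn_abs (habs x hx), isModulusIn_abs (habs φ hφ),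
      isInfIn_inf (hmem hx n), h⟩

end Sublattice

/-! ### The product algebra -/

section ProductAlgebra

variable {A : Type*} [NonUnitalRing A]

theorem power_mem_productAlgebra (a : A) (p : ℕ) : power a p ∈ productAlgebra A p :=
  ⟨fun _ => a, rfl⟩

variable [Lattice A] [IsOrderedAddMonoid A]

theorem HasWeakFactorization.exists_le_power (hw : HasWeakFactorization A) (hf : IsFAlgebra A)
    {p : ℕ} (hp : p ≠ 0) (z : A) : ∃ t, 0 ≤ t ∧ z ≤ power t p := by
  induction p using Nat.twoStepInduction generalizing z with
  | zero => exact absurd rfl hp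
  | one => exact ⟨|z|, abs_nonneg z, le_abs_self z⟩
  | more p _ ih =>
    obtain ⟨b, c, hbc⟩ := hw z
    obtain ⟨t, ht, hbt⟩ := ih p.succ_ne_zero |b|
    have htc : 0 ≤ t + |c| := add_nonneg ht (abs_nonneg c)
    have hbtc : |b| ≤ power (t + |c|) (p + 1) :=
      hbt.trans (hf.power_mono ht (le_add_of_nonneg_right (abs_nonneg c)) _)
    refine ⟨t + |c|, htc, ?_⟩
    calc z ≤ |b * c| := hbc.trans (le_abs_self _)
      _ = |b| * |c| := hf.abs_mul b c
      _ ≤ power (t + |c|) (p + 1) * (t + |c|) :=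
        hf.mul_le_mul hbtc (le_add_of_nonneg_left ht) (abs_nonneg c) (hf.power_nonneg htc _)

variable [Module ℝ A] [IsOrderedModule ℝ A] [IsScalarTower ℝ A A] [SMulCommClass ℝ A A]
  (hf : IsFAlgebra A) (harch : IsArchimedean A) (huc : IsUniformlyComplete A)
  {p : ℕ} (hp : p ≠ 0)
include hf harch huc hp

theorem exists_power_eq_abs {x : A} (hx : x ∈ productAlgebra A p) :
    ∃ r, 0 ≤ r ∧ power r p = |x| := by
  obtain ⟨g, rfl⟩ := hx
  obtain ⟨r, hr, -, hrg⟩ := hf.exists_root harch huc hp fun i => abs_nonneg (g i)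
  exact ⟨r, hr, hrg.trans (hf.abs_prod g).symm⟩

theorem exists_power_eq {x : A} (hx : x ∈ productAlgebra A p) (hx0 : 0 ≤ x) :
    ∃ r, 0 ≤ r ∧ power r p = x := by
  simpa only [abs_of_nonneg hx0] using exists_power_eq_abs hf harch huc hp hx

theorem abs_mem_productAlgebra {x : A} (hx : x ∈ productAlgebra A p) :
    |x| ∈ productAlgebra A p := by
  obtain ⟨r, -, hr⟩ := exists_power_eq_abs hf harch huc hp hx
  exact hr ▸ power_mem_productAlgebra r p

theorem smul_mem_productAlgebra {x : A} (hx : x ∈ productAlgebra A p) (hx0 : 0 ≤ x) {c : ℝ}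
    (hc : 0 ≤ c) : c • x ∈ productAlgebra A p := by
  obtain ⟨r, -, rfl⟩ := exists_power_eq hf harch huc hp hx hx0
  rw [← Real.rpow_inv_natCast_pow hc hp, ← power_smul]
  exact power_mem_productAlgebra _ p

theorem inf_mem_productAlgebra {x y : A} (hx : x ∈ productAlgebra A p)
    (hy : y ∈ productAlgebra A p) (hx0 : 0 ≤ x) (hy0 : 0 ≤ y) : x ⊓ y ∈ productAlgebra A p := by
  obtain ⟨r, hr, rfl⟩ := exists_power_eq hf harch huc hp hx hx0
  obtain ⟨s, hs, rfl⟩ := exists_power_eq hf harch huc hp hy hy0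
  rw [← hf.power_inf hr hs]
  exact power_mem_productAlgebra _ p

theorem isMajorantIn_productAlgebra_iff {φ z : A} (hφ : φ ∈ productAlgebra A p) :
    IsMajorantIn (productAlgebra A p) φ z ↔ z ∈ productAlgebra A p ∧ 0 ≤ z ∧
      ∀ x ∈ productAlgebra A p, ∃ c : ℝ, 0 < c ∧ ∀ n : ℕ, |x| ⊓ n • |φ| ≤ c • z := by
  refine isMajorantIn_iff (fun x hx => abs_mem_productAlgebra hf harch huc hp hx)
    (fun x hx y hy => inf_mem_productAlgebra hf harch huc hp hx hy) (fun x hx hx0 n => ?_) hφ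
  rw [← Nat.cast_smul_eq_nsmul ℝ]
  exact smul_mem_productAlgebra hf harch huc hp hx hx0 n.cast_nonneg

theorem mem_finiteElementsIn_of_abs_eq_power {φ r : A} (hφ : φ ∈ productAlgebra A p)
    (hr : r ∈ finiteElements A) (hrφ : |φ| = power |r| p) :
    φ ∈ finiteElementsIn (productAlgebra A p) := by
  obtain ⟨z, hz, hmaj⟩ := hr
  refine ⟨hφ, power z p, (isMajorantIn_productAlgebra_iff hf harch huc hp hφ).2
    ⟨power_mem_productAlgebra z p, hf.power_nonneg hz p, fun x hx => ?_⟩⟩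
  obtain ⟨k, hk, hkx⟩ := exists_power_eq_abs hf harch huc hp hx
  obtain ⟨c, hc, hcn⟩ := hmaj k
  refine ⟨c ^ p, pow_pos hc p, fun n => ?_⟩
  have hnr : 0 ≤ n • |r| := nsmul_nonneg (abs_nonneg r) n
  have hpow : n • power |r| p ≤ power (n • |r|) p := by
    rw [← Nat.cast_smul_eq_nsmul ℝ, ← Nat.cast_smul_eq_nsmul ℝ, power_smul]
    refine smul_le_smul_of_nonneg_right ?_ (hf.power_nonneg (abs_nonneg r) p)
    exact_mod_cast Nat.le_self_pow hp n
  calc |x| ⊓ n • |φ| = power k p ⊓ n • power |r| p := by rw [hkx, hrφ]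
    _ ≤ power k p ⊓ power (n • |r|) p := inf_le_inf_left _ hpow
    _ = power (|k| ⊓ n • |r|) p := by rw [abs_of_nonneg hk, hf.power_inf hk hnr]
    _ ≤ power (c • z) p := hf.power_mono (le_inf (abs_nonneg k) hnr) (hcn n) p
    _ = c ^ p • power z p := power_smul c z p

theorem prod_mem_finiteElementsIn {g : Fin p → A} (hg : ∀ i, g i ∈ finiteElements A) :
    prod p g ∈ finiteElementsIn (productAlgebra A p) := by
  obtain ⟨r, hr, hrle, hrg⟩ := hf.exists_root harch huc hp fun i => abs_nonneg (g i)
  have hsum : ∑ i, |g i| ∈ finiteElements A := sum_mem_finiteElements _ _ fun i _ =>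
    mem_finiteElements_of_abs_le (hg i) (abs_abs (g i)).le
  refine mem_finiteElementsIn_of_abs_eq_power hf harch huc hp ⟨g, rfl⟩
    (mem_finiteElements_of_abs_le hsum (abs_le_abs_of_nonneg hr hrle)) ?_
  rw [hf.abs_prod, abs_of_nonneg hr, hrg]

theorem mem_finiteElementsIn_of_hasWeakFactorization (hw : HasWeakFactorization A) {φ : A}
    (hφ : φ ∈ finiteElements A) (hmem : φ ∈ productAlgebra A p) :
    φ ∈ finiteElementsIn (productAlgebra A p) := by
  obtain ⟨z, -, hmaj⟩ := hφ
  obtain ⟨t, ht, hzt⟩ := hw.exists_le_power hf hp z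
  refine ⟨hmem, power t p, (isMajorantIn_productAlgebra_iff hf harch huc hp hmem).2
    ⟨power_mem_productAlgebra t p, hf.power_nonneg ht p, fun x _ => ?_⟩⟩
  obtain ⟨c, hc, hcn⟩ := hmaj x
  exact ⟨c, hc, fun n => (hcn n).trans (smul_le_smul_of_nonneg_left hzt hc.le)⟩

variable (hs : IsSemiprime A)
include hs

theorem existsUnique_power_eq_abs {x : A} (hx : x ∈ productAlgebra A p) :
    ∃! r : A, 0 ≤ r ∧ power r p = |x| := by
  obtain ⟨r, hr, hrx⟩ := exists_power_eq_abs hf harch huc hp hx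
  refine ⟨r, ⟨hr, hrx⟩, fun s ⟨hs0, hsx⟩ => le_antisymm ?_ ?_⟩
  · exact hf.le_of_power_le hs hs0 hr hp (hsx.trans hrx.symm).le
  · exact hf.le_of_power_le hs hr hs0 hp (hrx.trans hsx.symm).le

theorem mem_finiteElements_of_abs_power_eq {φ r : A}
    (hφ : φ ∈ finiteElementsIn (productAlgebra A p)) (hr : |power r p| = |φ|) :
    r ∈ finiteElements A := by
  obtain ⟨hmem, z, hz⟩ := hφ
  obtain ⟨hzmem, hz0, hmaj⟩ := (isMajorantIn_productAlgebra_iff hf harch huc hp hmem).1 hz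
  obtain ⟨t, ht, rfl⟩ := exists_power_eq hf harch huc hp hzmem hz0
  refine ⟨t, ht, fun x => ?_⟩
  obtain ⟨c, hc, hcn⟩ := hmaj _ (power_mem_productAlgebra x p)
  refine ⟨c + 1, by positivity, fun n => ?_⟩
  have hnr : 0 ≤ n • |r| := nsmul_nonneg (abs_nonneg r) n
  have hpow : power (n • |r|) p = n ^ p • |φ| := by
    rw [← Nat.cast_smul_eq_nsmul ℝ, power_smul, ← hf.abs_power, hr, ← Nat.cast_smul_eq_nsmul ℝ,
      Nat.cast_pow]
  have hcp : c ≤ (c + 1) ^ p :=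
    (le_add_of_nonneg_right zero_le_one).trans (le_self_pow₀ (by linarith) hp)
  refine hf.le_of_power_le hs (le_inf (abs_nonneg x) hnr) (smul_nonneg (by positivity) ht) hp ?_
  calc power (|x| ⊓ n • |r|) p = |power x p| ⊓ n ^ p • |φ| := by
        rw [hf.power_inf (abs_nonneg x) hnr, hpow, hf.abs_power]
    _ ≤ c • power t p := hcn _
    _ ≤ (c + 1) ^ p • power t p := smul_le_smul_of_nonneg_right hcp hz0
    _ = power ((c + 1) • t) p := (power_smul _ t p).symm

theorem finiteElementsIn_productAlgebra_subset :
    finiteElementsIn (productAlgebra A p) ⊆ finiteElements A := by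
  intro φ hφ
  obtain ⟨r, hr, hrφ⟩ := exists_power_eq_abs hf harch huc hp hφ.1
  have hfin : r ∈ finiteElements A :=
    mem_finiteElements_of_abs_power_eq hf harch huc hp hs hφ (by rw [hrφ, abs_abs])
  refine mem_finiteElements_of_disjoint_imp harch hfin fun w hw => ?_
  rw [abs_of_nonneg hr] at hw
  rw [← hrφ]
  exact hf.inf_power_eq_zero hw p

theorem finiteElementsIn_productAlgebra_eq (hw : HasWeakFactorization A) :
    finiteElementsIn (productAlgebra A p) = finiteElements A ∩ productAlgebra A p :=
  Set.Subset.antisymm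
    (fun _ hφ => ⟨finiteElementsIn_productAlgebra_subset hf harch huc hp hs hφ, hφ.1⟩)
    fun _ hφ => mem_finiteElementsIn_of_hasWeakFactorization hf harch huc hp hw hφ.1 hφ.2

end ProductAlgebra

end FAlgebra

theorem corollary5 {A : Type*} [NonUnitalRing A] [Lattice A] [IsOrderedAddMonoid A]
    [Module ℝ A] [IsOrderedModule ℝ A] [IsScalarTower ℝ A A] [SMulCommClass ℝ A A]
    (harch : FAlgebra.IsArchimedean A) (huc : FAlgebra.IsUniformlyComplete A)
    (hf : FAlgebra.IsFAlgebra A) (p : ℕ) (hp : 2 ≤ p) :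
    -- 1. products of finite elements
    (∀ g : Fin p → A, (∀ i, g i ∈ FAlgebra.finiteElements A) →
      FAlgebra.prod p g ∈ FAlgebra.finiteElementsIn (FAlgebra.productAlgebra A p)) ∧
    (FAlgebra.IsSemiprime A →
      -- 2. roots of products that are finite in the product algebra
      (∀ g : Fin p → A,
        FAlgebra.prod p g ∈ FAlgebra.finiteElementsIn (FAlgebra.productAlgebra A p) →
        (∃! r : A, 0 ≤ r ∧ FAlgebra.power r p = |FAlgebra.prod p g|) ∧
        (∀ r : A, FAlgebra.power r p = |FAlgebra.prod p g| → r ∈ FAlgebra.finiteElements A) ∧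
        (∀ r : A, FAlgebra.power r p = FAlgebra.prod p g → r ∈ FAlgebra.finiteElements A)) ∧
      -- 3. roots of products of finite elements
      (∀ g : Fin p → A, (∀ i, g i ∈ FAlgebra.finiteElements A) →
        (∃! r : A, 0 ≤ r ∧ FAlgebra.power r p = |FAlgebra.prod p g|) ∧
        (∀ r : A, FAlgebra.power r p = |FAlgebra.prod p g| → r ∈ FAlgebra.finiteElements A) ∧
        (∀ r : A, FAlgebra.power r p = FAlgebra.prod p g → r ∈ FAlgebra.finiteElements A)) ∧
      -- 4. inclusion
      FAlgebra.finiteElementsIn (FAlgebra.productAlgebra A p) ⊆ FAlgebra.finiteElements A ∧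
      -- 5. equality under the weak factorization property
      (FAlgebra.HasWeakFactorization A →
        FAlgebra.finiteElementsIn (FAlgebra.productAlgebra A p) =
          FAlgebra.finiteElements A ∩ FAlgebra.productAlgebra A p)) := by
  have hp₀ : p ≠ 0 := by lia
  have hprod (g : Fin p → A) := FAlgebra.prod_mem_finiteElementsIn hf harch huc hp₀ (g := g)
  refine ⟨hprod, fun hs => ?_⟩
  have hroots (g : Fin p → A)
      (hg : FAlgebra.prod p g ∈ FAlgebra.finiteElementsIn (FAlgebra.productAlgebra A p)) :
      (∃! r : A, 0 ≤ r ∧ FAlgebra.power r p = |FAlgebra.prod p g|) ∧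
      (∀ r : A, FAlgebra.power r p = |FAlgebra.prod p g| → r ∈ FAlgebra.finiteElements A) ∧
      (∀ r : A, FAlgebra.power r p = FAlgebra.prod p g → r ∈ FAlgebra.finiteElements A) := by
    have hroot {r : A} :=
      FAlgebra.mem_finiteElements_of_abs_power_eq hf harch huc hp₀ hs hg (r := r)
    exact ⟨FAlgebra.existsUnique_power_eq_abs hf harch huc hp₀ hs hg.1,
      fun r hr => hroot (by rw [hr, abs_abs]), fun r hr => hroot (by rw [hr])⟩
  exact ⟨hroots, fun g hg => hroots g (hprod g hg),
    FAlgebra.finiteElementsIn_productAlgebra_subset hf harch huc hp₀ hs,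
    FAlgebra.finiteElementsIn_productAlgebra_eq hf harch huc hp₀ hs⟩
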